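/- Let $\Lambda$ be an ordered division ring and let $M$ be an ordered (left) vector space over $\Lambda$, that is, a $\Lambda$-vector space with a total order compatible with addition and such that $\lambda x>0$ whenever $\lambda>0$ in $\Lambda$ and $x>0$ in $M$. Let $r,d_1,\dots,d_r$ be positive integers and let $E\subseteq\prod_{i=1}^r M^{d_i}$ be a semilinear relation, that is, a set definable (with parameters) in the first-order structure $\langle M,<,+,(x\mapsto\lambda x)_{\lambda\in\Lambda}\rangle$. Then $\mathrm{Zar}^\infty(E)$ holds: if $E$ contains no grid $B_1\times\dots\times B_r$ in which every $B_i\subseteq M^{d_i}$ is infinite, then there is a real number $\alpha>0$ such that for all finite sets $B_i\subseteq M^{d_i}$ $(1\le i\le r)$, $$\bigl|E\cap(B_1\times\dots\times B_r)\bigr|\;\le\;\alpha\sum_{1\le i_1<\dots<i_{r-1}\le r}\ \prod_{j=1}^{r-1}|B_{i_j}| .$$ -/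

import Mathlib

namespace Zarankiewicz

universe u v

/-- Function symbols of the language of ordered `Λ`-vector spaces: binary addition and, for every
`c : Λ`, a unary symbol for the map `x ↦ c • x`. -/
inductive OVSFunc (Λ : Type u) : ℕ → Type u
  | add : OVSFunc Λ 2
  | smul (c : Λ) : OVSFunc Λ 1

/-- Relation symbols of the language of ordered vector spaces: the strict order. -/
inductive OVSRel : ℕ → Type
  | lt : OVSRel 2

/-- The first-order language `{<, +, (x ↦ c • x)_{c : Λ}}`. -/
def ovsLanguage (Λ : Type u) : FirstOrder.Language.{u, 0} where
  Functions := OVSFunc Λ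
  Relations := OVSRel

/-- An ordered `Λ`-vector space `M` as the first-order structure
`⟨M, <, +, (x ↦ c • x)_{c : Λ}⟩`. -/
instance ovsStructure (Λ : Type u) (M : Type v) [Add M] [LT M] [SMul Λ M] :
    (ovsLanguage Λ).Structure M where
  funMap := fun f x =>
    match f, x with
    | OVSFunc.add, x => x 0 + x 1
    | OVSFunc.smul c, x => c • x 0
  RelMap := fun R x =>
    match R, x with
    | OVSRel.lt, x => x 0 < x 1

/-- A relation `E ⊆ ∏ i, M ^ (d i)` is semilinear if, after identifying `∏ i, M ^ (d i)` with
`M ^ n` for `n = ∑ i, d i` (the `n` coordinates being indexed by the pairs `(i, j)` with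
`j < d i`), it is definable, with parameters from `M`, in
the structure `⟨M, <, +, (x ↦ c • x)_{c : Λ}⟩`. -/
def IsSemilinear (Λ : Type u) {M : Type v} [Add M] [LT M] [SMul Λ M] {r : ℕ} {d : Fin r → ℕ}
    (E : Set ((i : Fin r) → (Fin (d i) → M))) : Prop :=
  (Set.univ : Set M).Definable (ovsLanguage Λ)
    {x : (Σ i : Fin r, Fin (d i)) → M | (fun i j => x ⟨i, j⟩) ∈ E}

/-- The grid `B 0 × ⋯ × B (r - 1)` with sides `B i ⊆ M ^ (d i)`. -/
def grid {M : Type v} {r : ℕ} {d : Fin r → ℕ} (B : (i : Fin r) → Set (Fin (d i) → M)) :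
    Set ((i : Fin r) → (Fin (d i) → M)) :=
  {x | ∀ i, x i ∈ B i}

/-- `E` is `∞`-free: it contains no grid all of whose sides are infinite. -/
def InftyFree {M : Type v} {r : ℕ} {d : Fin r → ℕ}
    (E : Set ((i : Fin r) → (Fin (d i) → M))) : Prop :=
  ¬ ∃ B : (i : Fin r) → Set (Fin (d i) → M), (∀ i, (B i).Infinite) ∧ grid B ⊆ E

/-- `δ(B)`: the sum, over all choices of `r - 1` of the `r` sides of a finite grid `B`, of the
product of the cardinalities of the chosen sides. -/
def delta {M : Type v} {r : ℕ} {d : Fin r → ℕ}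
    (B : (i : Fin r) → Finset (Fin (d i) → M)) : ℕ :=
  ∑ s ∈ (Finset.univ : Finset (Fin r)).powersetCard (r - 1), ∏ i ∈ s, (B i).card

/-- `E` has linear Zarankiewicz bounds (for the class of all grids). -/
def HasLinearZBounds {M : Type v} {r : ℕ} {d : Fin r → ℕ}
    (E : Set ((i : Fin r) → (Fin (d i) → M))) : Prop :=
  ∃ α : ℝ, 0 < α ∧ ∀ B : (i : Fin r) → Finset (Fin (d i) → M),
    ((E ∩ grid (fun i => (B i : Set (Fin (d i) → M)))).ncard : ℝ) ≤ α * (delta B : ℝ)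

/-- The Zarankiewicz statement `Zar^∞(E)`. -/
def ZarInfty {M : Type v} {r : ℕ} {d : Fin r → ℕ}
    (E : Set ((i : Fin r) → (Fin (d i) → M))) : Prop :=
  InftyFree E → HasLinearZBounds E

end Zarankiewicz

/-!
A semilinear set is a finite union of cells, that is, of solution sets of finitely many affine
equations and strict affine inequalities: this is quantifier elimination for ordered vector spaces
(`isCellUnion_of_definable`), whose only nontrivial step is Fourier–Motzkin elimination of one
variable (`IsCell.image_fst`). Both hypothesis and conclusion of `Zar^∞` pass between a finite union
and its members, so it suffices to treat one cell (`IsCell.zarInfty`).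

The equations of a cell have the form `∑ i, F i (x i) = c` with `F i` given by a matrix over `Λ`.
If some `F i` has trivial kernel on `M ^ (d i)`, a point of the cell is determined by its blocks
other than the `i`-th, so a grid `B` contains at most `∏ j ≠ i, |B j|` points of the cell
(`hasLinearZBounds_of_injOn`). If no `F i` has trivial kernel, then for every `i` the columns of the
matrix satisfy a nontrivial relation `b i` over `Λ` (`exists_ne_zero_or_eq_zero`). Around a point `p`
of the cell, the infinite sets `{p i + b i • m | 0 < m < ε}` then span a grid on which the equations
hold, and for small `ε` the strict inequalities hold there too
(`exists_pos_forall_pos_add_sum`). So an `∞`-free nonempty cell is always of the first kind.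

Affine functions enter the elimination step only through a `Λ`-submodule `L` of `X → M`, and adding
a variable replaces `L` by `prodAffine L`, which keeps the argument independent of coordinates.
The elimination uses that `M` is dense without endpoints; for trivial `M`, where this fails, the
claim is immediate.
-/

namespace Zarankiewicz

open FirstOrder FirstOrder.Language Set

universe u v w

/-! ### Cells and finite unions of cells -/

section Cells

variable {Λ : Type u} {M : Type v} {X : Type w}
  [DivisionRing Λ] [AddCommGroup M] [LinearOrder M] [Module Λ M]

/-- A cell with respect to a space `L` of functions `X → M`: the solution set of a finite system of
equations `f x = 0` and strict inequalities `0 < g x` with `f, g ∈ L`. It may be empty. -/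
def IsCell (L : Submodule Λ (X → M)) (s : Set X) : Prop :=
  ∃ F G : Set (X → M), F.Finite ∧ G.Finite ∧ F ⊆ L ∧ G ⊆ L ∧
    s = {x | (∀ f ∈ F, f x = 0) ∧ ∀ g ∈ G, 0 < g x}

/-- Finite unions of cells. -/
inductive IsCellUnion (L : Submodule Λ (X → M)) : Set X → Prop
  | empty : IsCellUnion L ∅
  | cell_union {s t : Set X} : IsCell L s → IsCellUnion L t → IsCellUnion L (s ∪ t)

variable {L : Submodule Λ (X → M)} {s t : Set X}

theorem IsCell.univ : IsCell L (univ : Set X) :=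
  ⟨∅, ∅, finite_empty, finite_empty, empty_subset _, empty_subset _, by simp⟩

theorem IsCell.zero {f : X → M} (hf : f ∈ L) : IsCell L {x | f x = 0} :=
  ⟨{f}, ∅, finite_singleton f, finite_empty, singleton_subset_iff.2 hf, empty_subset _, by simp⟩

theorem IsCell.pos {f : X → M} (hf : f ∈ L) : IsCell L {x | 0 < f x} :=
  ⟨∅, {f}, finite_empty, finite_singleton f, empty_subset _, singleton_subset_iff.2 hf, by simp⟩

theorem IsCell.inter (hs : IsCell L s) (ht : IsCell L t) : IsCell L (s ∩ t) := by
  obtain ⟨F, G, hF, hG, hFL, hGL, rfl⟩ := hs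
  obtain ⟨F', G', hF', hG', hFL', hGL', rfl⟩ := ht
  refine ⟨F ∪ F', G ∪ G', hF.union hF', hG.union hG', union_subset hFL hFL',
    union_subset hGL hGL', ?_⟩
  ext x
  simp only [mem_inter_iff, mem_ofPred_eq, mem_union, or_imp, forall_and]
  tauto

theorem IsCell.biInter {ι : Type*} {S : Set ι} (hS : S.Finite) {t : ι → Set X}
    (ht : ∀ i ∈ S, IsCell L (t i)) : IsCell L (⋂ i ∈ S, t i) := by
  induction S, hS using Set.Finite.induction_on with
  | empty => simpa using IsCell.univ
  | insert _ _ ih =>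
    rw [biInter_insert]
    exact (ht _ (mem_insert _ _)).inter (ih fun i hi => ht i (mem_insert_of_mem _ hi))

theorem IsCell.comap {Y : Type*} {L' : Submodule Λ (Y → M)} {φ : Y → X}
    (hφ : ∀ f ∈ L, f ∘ φ ∈ L') (hs : IsCell L s) : IsCell L' (φ ⁻¹' s) := by
  obtain ⟨F, G, hF, hG, hFL, hGL, rfl⟩ := hs
  refine ⟨(· ∘ φ) '' F, (· ∘ φ) '' G, hF.image _, hG.image _, ?_, ?_, ?_⟩
  · rintro _ ⟨f, hf, rfl⟩
    exact hφ f (hFL hf)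
  · rintro _ ⟨f, hf, rfl⟩
    exact hφ f (hGL hf)
  · ext x
    simp

theorem IsCell.isCellUnion (hs : IsCell L s) : IsCellUnion L s := by
  simpa using IsCellUnion.cell_union hs .empty

theorem IsCellUnion.union (hs : IsCellUnion L s) (ht : IsCellUnion L t) :
    IsCellUnion L (s ∪ t) := by
  induction hs with
  | empty => simpa using ht
  | cell_union h _ ih => rw [union_assoc]; exact .cell_union h ih

theorem IsCellUnion.inter (hs : IsCellUnion L s) (ht : IsCellUnion L t) :
    IsCellUnion L (s ∩ t) := by
  induction hs with
  | empty => simpa using IsCellUnion.empty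
  | @cell_union s _ h _ ih =>
    rw [union_inter_distrib_right]
    refine IsCellUnion.union ?_ ih
    clear ih
    induction ht with
    | empty => simpa using IsCellUnion.empty
    | cell_union h' _ ih' => rw [inter_union_distrib_left]; exact .cell_union (h.inter h') ih'

theorem IsCellUnion.biUnion {ι : Type*} {S : Set ι} (hS : S.Finite) {t : ι → Set X}
    (ht : ∀ i ∈ S, IsCellUnion L (t i)) : IsCellUnion L (⋃ i ∈ S, t i) := by
  induction S, hS using Set.Finite.induction_on with
  | empty => simpa using IsCellUnion.empty
  | insert _ _ ih =>
    rw [biUnion_insert]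
    exact (ht _ (mem_insert _ _)).union (ih fun i hi => ht i (mem_insert_of_mem _ hi))

theorem IsCellUnion.comap {Y : Type*} {L' : Submodule Λ (Y → M)} {φ : Y → X}
    (hφ : ∀ f ∈ L, f ∘ φ ∈ L') (hs : IsCellUnion L s) : IsCellUnion L' (φ ⁻¹' s) := by
  induction hs with
  | empty => exact .empty
  | cell_union h _ ih => exact .cell_union (h.comap hφ) ih

end Cells

section CellsCompl

variable {Λ : Type u} {M : Type v} {X : Type w}
  [DivisionRing Λ] [AddCommGroup M] [LinearOrder M] [IsOrderedAddMonoid M] [Module Λ M]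
  {L : Submodule Λ (X → M)} {s : Set X}

theorem IsCell.compl (hs : IsCell L s) : IsCellUnion L sᶜ := by
  obtain ⟨F, G, hF, hG, hFL, hGL, rfl⟩ := hs
  have key : {x | (∀ f ∈ F, f x = 0) ∧ ∀ g ∈ G, 0 < g x}ᶜ =
      (⋃ f ∈ F, ({x | 0 < f x} ∪ {x | 0 < (-f) x})) ∪
        ⋃ g ∈ G, ({x | g x = 0} ∪ {x | 0 < (-g) x}) := by
    ext x
    simp only [mem_compl_iff, mem_ofPred_eq, not_and_or, not_forall, mem_union, mem_iUnion,
      Pi.neg_apply, Left.neg_pos_iff, not_lt, exists_prop, le_iff_eq_or_lt, ← ne_eq,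
      ← lt_or_lt_iff_ne]
    simp only [or_comm]
  rw [key]
  exact (IsCellUnion.biUnion hF fun f hf => (IsCell.pos (hFL hf)).isCellUnion.union
      (IsCell.pos (L.neg_mem (hFL hf))).isCellUnion).union
    (IsCellUnion.biUnion hG fun g hg => (IsCell.zero (hGL hg)).isCellUnion.union
      (IsCell.pos (L.neg_mem (hGL hg))).isCellUnion)

theorem IsCellUnion.compl (hs : IsCellUnion L s) : IsCellUnion L sᶜ := by
  induction hs with
  | empty => simpa using IsCell.univ.isCellUnion
  | cell_union h _ ih => rw [compl_union]; exact h.compl.inter ih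

end CellsCompl

/-! ### Fourier–Motzkin elimination -/

section Elimination

variable {Λ : Type u} {M : Type v} {X : Type w}
  [DivisionRing Λ] [AddCommGroup M] [Module Λ M]

/-- The functions `(x, m) ↦ g x + a • m` on `X × M` with `g ∈ L` and `a : Λ`. -/
def prodAffine (L : Submodule Λ (X → M)) : Submodule Λ (X × M → M) where
  carrier := {f | ∃ g ∈ L, ∃ a : Λ, f = fun p => g p.1 + a • p.2}
  zero_mem' := ⟨0, L.zero_mem, 0, by ext; simp⟩
  add_mem' := by
    rintro _ _ ⟨g, hg, a, rfl⟩ ⟨g', hg', a', rfl⟩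
    refine ⟨g + g', L.add_mem hg hg', a + a', ?_⟩
    ext p
    simp only [Pi.add_apply, add_smul]
    abel
  smul_mem' := by
    rintro c _ ⟨g, hg, a, rfl⟩
    refine ⟨c • g, L.smul_mem c hg, c * a, ?_⟩
    ext p
    simp [mul_smul]

theorem comp_section_mem {L : Submodule Λ (X → M)} {h : X → M} (hh : h ∈ L) :
    ∀ f ∈ prodAffine L, f ∘ (fun x => (x, h x)) ∈ L := by
  rintro _ ⟨g, hg, a, rfl⟩
  exact L.add_mem hg (L.smul_mem a hh)

variable [LinearOrder Λ] [IsStrictOrderedRing Λ] [LinearOrder M] [IsOrderedAddMonoid M]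
  [IsStrictOrderedModule Λ M]

theorem pos_add_smul_iff_of_pos {a : Λ} (ha : 0 < a) (y m : M) :
    0 < y + a • m ↔ -(a⁻¹ • y) < m := by
  rw [← smul_pos_iff_of_pos_left (inv_pos.2 ha), smul_add, inv_smul_smul₀ ha.ne',
    neg_lt_iff_pos_add']

theorem pos_add_smul_iff_of_neg {a : Λ} (ha : a < 0) (y m : M) :
    0 < y + a • m ↔ m < -(a⁻¹ • y) := by
  rw [← smul_pos_iff_of_pos_left (inv_pos.2 (neg_pos.2 ha)), smul_add, inv_neg, neg_smul, neg_smul,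
    inv_smul_smul₀ ha.ne, ← sub_eq_add_neg, sub_pos]

theorem denselyOrdered_of_module (Λ M : Type*)
    [DivisionRing Λ] [LinearOrder Λ] [IsStrictOrderedRing Λ]
    [AddCommGroup M] [LinearOrder M] [IsOrderedAddMonoid M] [Module Λ M]
    [IsStrictOrderedModule Λ M] :
    DenselyOrdered M where
  dense x y hxy := by
    refine ⟨(2⁻¹ : Λ) • (x + y), ?_, ?_⟩
    · have h : x = (2⁻¹ : Λ) • (x + x) := by
        rw [← two_smul Λ x, inv_smul_smul₀ two_ne_zero]
      conv_lhs => rw [h]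
      exact smul_lt_smul_of_pos_left (by gcongr) (by positivity)
    · have h : y = (2⁻¹ : Λ) • (y + y) := by
        rw [← two_smul Λ y, inv_smul_smul₀ two_ne_zero]
      conv_rhs => rw [h]
      exact smul_lt_smul_of_pos_left (by gcongr) (by positivity)

variable [Nontrivial M]

/-- If an equation of the system really involves the last variable, that variable can be
substituted; otherwise its lower and upper bounds are compared pairwise, which suffices because
`M` is a dense order without endpoints. -/
theorem IsCell.image_fst {L : Submodule Λ (X → M)} {s : Set (X × M)}
    (hs : IsCell (prodAffine L) s) : IsCell L (Prod.fst '' s) := by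
  have hs' := hs
  obtain ⟨F, G, hF, hG, hFL, hGL, rfl⟩ := hs'
  have hFL' : ∀ f ∈ F, ∃ g ∈ L, ∃ a : Λ, f = fun p => g p.1 + a • p.2 := fun f hf => hFL hf
  have hGL' : ∀ f ∈ G, ∃ g ∈ L, ∃ a : Λ, f = fun p => g p.1 + a • p.2 := fun f hf => hGL hf
  by_cases hsub : ∃ f ∈ F, ∃ g ∈ L, ∃ a : Λ, a ≠ 0 ∧ f = fun p => g p.1 + a • p.2
  · obtain ⟨f, hfF, g, hg, a, ha, rfl⟩ := hsub
    have hh : -(a⁻¹ • g) ∈ L := L.neg_mem (L.smul_mem _ hg)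
    convert hs.comap (comp_section_mem hh) using 1
    ext x
    constructor
    · rintro ⟨⟨x, m⟩, hm, rfl⟩
      have h0 : g x + a • m = 0 := hm.1 _ hfF
      have : m = (-(a⁻¹ • g)) x := by
        rw [Pi.neg_apply, Pi.smul_apply, eq_neg_of_add_eq_zero_left h0, smul_neg,
          inv_smul_smul₀ ha, neg_neg]
      rw [mem_preimage, ← this]
      exact hm
    · intro hx
      exact ⟨_, hx, rfl⟩
  · push Not at hsub
    have : DenselyOrdered M := denselyOrdered_of_module Λ M
    -- coefficients of the inequalities
    choose! g hg a hga using hGL'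
    have hF0 : ∀ f ∈ F, ∀ x m, f (x, m) = f (x, 0) := by
      intro f hf x m
      obtain ⟨g', hg', a', ha'⟩ := hFL' f hf
      by_cases h0 : a' = 0
      · rw [ha', h0]; simp
      · exact absurd ha' (hsub f hf g' hg' a' h0)
    have hGap : ∀ f ∈ G, ∀ x m, f (x, m) = g f x + a f • m := by
      intro f hf x m
      conv_lhs => rw [hga f hf]
    have key : Prod.fst '' {x | (∀ f ∈ F, f x = 0) ∧ ∀ g ∈ G, 0 < g x} =
        ((fun x => (x, (0 : X → M) x)) ⁻¹' ⋂ f ∈ F, {p | f p = 0}) ∩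
        ((⋂ f ∈ {f ∈ G | a f = 0}, {x | 0 < g f x}) ∩
          ⋂ q ∈ {f ∈ G | 0 < a f} ×ˢ {f ∈ G | a f < 0},
            {x | 0 < (-((a q.2)⁻¹ • g q.2) - -((a q.1)⁻¹ • g q.1)) x}) := by
      ext x
      simp only [mem_image, mem_ofPred_eq, Prod.exists, exists_and_right, exists_eq_right,
        mem_inter_iff, mem_preimage, mem_iInter, mem_prod, Prod.forall, Pi.zero_apply,
        Pi.sub_apply, Pi.neg_apply, Pi.smul_apply, sub_pos, and_imp]
      constructor
      · rintro ⟨m, hm1, hm2⟩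
        refine ⟨fun f hf => by rw [← hF0 f hf x m]; exact hm1 f hf, fun f hf h0 => ?_, ?_⟩
        · have := hm2 f hf
          rwa [hGap f hf, h0, zero_smul, add_zero] at this
        · intro f f' hf hfa hf' hfa'
          have h1 := hm2 f hf
          have h2 := hm2 f' hf'
          rw [hGap f hf, pos_add_smul_iff_of_pos hfa] at h1
          rw [hGap f' hf', pos_add_smul_iff_of_neg hfa'] at h2
          exact h1.trans h2
      · rintro ⟨h1, h2, h3⟩
        have hlo : {f ∈ G | 0 < a f}.Finite := hG.subset (sep_subset _ _)
        have hhi : {f ∈ G | a f < 0}.Finite := hG.subset (sep_subset _ _)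
        obtain ⟨m, hm1, hm2⟩ := Order.exists_between_finsets
          (hlo.toFinset.image fun f => -((a f)⁻¹ • g f x))
          (hhi.toFinset.image fun f => -((a f)⁻¹ • g f x)) (by
            intro y hy z hz
            simp only [Finset.mem_image, Finite.mem_toFinset, mem_ofPred_eq] at hy hz
            obtain ⟨f, ⟨hf, hfa⟩, rfl⟩ := hy
            obtain ⟨f', ⟨hf', hfa'⟩, rfl⟩ := hz
            exact h3 f f' hf hfa hf' hfa')
        refine ⟨m, fun f hf => by rw [hF0 f hf]; exact h1 f hf, fun f hf => ?_⟩
        rw [hGap f hf]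
        rcases lt_trichotomy (a f) 0 with h | h | h
        · rw [pos_add_smul_iff_of_neg h]
          exact hm2 _ (Finset.mem_image_of_mem _ (hhi.mem_toFinset.2 ⟨hf, h⟩))
        · rw [h, zero_smul, add_zero]
          exact h2 f hf h
        · rw [pos_add_smul_iff_of_pos h]
          exact hm1 _ (Finset.mem_image_of_mem _ (hlo.mem_toFinset.2 ⟨hf, h⟩))
    rw [key]
    refine IsCell.inter ((IsCell.biInter hF fun f hf => IsCell.zero (hFL hf)).comap
      (comp_section_mem L.zero_mem)) (IsCell.inter ?_ ?_)
    · exact IsCell.biInter (hG.subset (sep_subset _ _)) fun f hf => IsCell.pos (hg f hf.1)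
    · refine IsCell.biInter ((hG.subset (sep_subset _ _)).prod (hG.subset (sep_subset _ _)))
        fun q hq => IsCell.pos (L.sub_mem ?_ ?_)
      · exact L.neg_mem (L.smul_mem _ (hg _ hq.2.1))
      · exact L.neg_mem (L.smul_mem _ (hg _ hq.1.1))

theorem IsCellUnion.image_fst {L : Submodule Λ (X → M)} {s : Set (X × M)}
    (hs : IsCellUnion (prodAffine L) s) : IsCellUnion L (Prod.fst '' s) := by
  induction hs with
  | empty => simpa using IsCellUnion.empty
  | cell_union h _ ih => rw [image_union]; exact .cell_union h.image_fst ih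

end Elimination

/-! ### Quantifier elimination -/

section Definable

variable {Λ : Type u} {M : Type v} {ι : Type w} [Fintype ι]
  [DivisionRing Λ] [AddCommGroup M] [Module Λ M]

variable (Λ M ι) in
/-- The affine functions `x ↦ c + ∑ i, a i • x i` on `M ^ ι`. -/
def affine : Submodule Λ ((ι → M) → M) where
  carrier := {f | ∃ (c : M) (a : ι → Λ), f = fun x => c + ∑ i, a i • x i}
  zero_mem' := ⟨0, 0, by ext; simp⟩
  add_mem' := by
    rintro _ _ ⟨c, a, rfl⟩ ⟨c', a', rfl⟩
    refine ⟨c + c', a + a', ?_⟩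
    ext p
    simp only [Pi.add_apply, add_smul, Finset.sum_add_distrib]
    abel
  smul_mem' := by
    rintro k _ ⟨c, a, rfl⟩
    refine ⟨k • c, k • a, ?_⟩
    ext p
    simp [mul_smul, Finset.smul_sum]

theorem const_mem_affine (c : M) : (fun _ => c) ∈ affine Λ M ι := ⟨c, 0, by simp⟩

theorem eval_mem_affine (i : ι) : (fun x => x i) ∈ affine Λ M ι := by
  classical
  refine ⟨0, Pi.single i 1, ?_⟩
  ext x
  rw [zero_add, Finset.sum_eq_single i] <;> simp +contextual

theorem comp_snoc_mem {n : ℕ} : ∀ f ∈ affine Λ M (ι ⊕ Fin (n + 1)),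
    (f ∘ fun p : (ι ⊕ Fin n → M) × M =>
      Sum.elim (p.1 ∘ Sum.inl) (Fin.snoc (p.1 ∘ Sum.inr) p.2 : Fin (n + 1) → M)) ∈
      prodAffine (affine Λ M (ι ⊕ Fin n)) := by
  rintro _ ⟨c, a, rfl⟩
  refine ⟨fun x => c + ∑ i, Sum.elim (a ∘ Sum.inl) (fun j => a (Sum.inr j.castSucc)) i • x i,
    ⟨c, _, rfl⟩, a (Sum.inr (Fin.last n)), ?_⟩
  ext p
  simp [Fin.sum_univ_castSucc, add_assoc]

variable [LinearOrder M]

theorem realize_mem_affine (t : ((ovsLanguage Λ)[[(Set.univ : Set M)]]).Term ι) :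
    (fun x : ι → M => t.realize x) ∈ affine Λ M ι := by
  induction t with
  | var i => exact eval_mem_affine i
  | @func n f ts ih =>
    rcases f with f | f
    · cases f with
      | add =>
        exact (affine Λ M ι).add_mem (ih 0) (ih 1)
      | smul c => exact (affine Λ M ι).smul_mem c (ih 0)
    · cases n with
      | zero => exact const_mem_affine (f : (Set.univ : Set M)).1
      | succ n => cases n <;> exact f.elim

variable [LinearOrder Λ] [IsStrictOrderedRing Λ] [IsOrderedAddMonoid M]
  [IsStrictOrderedModule Λ M] [Nontrivial M]

theorem isCellUnion_realize {n : ℕ}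
    (φ : ((ovsLanguage Λ)[[(Set.univ : Set M)]]).BoundedFormula ι n) :
    IsCellUnion (affine Λ M (ι ⊕ Fin n)) {x | φ.Realize (x ∘ Sum.inl) (x ∘ Sum.inr)} := by
  induction φ with
  | falsum => exact .empty
  | equal t t' =>
    convert (IsCell.zero ((affine Λ M _).sub_mem (realize_mem_affine t)
      (realize_mem_affine t'))).isCellUnion using 1
    ext x
    simp [BoundedFormula.Realize, sub_eq_zero, ← Sum.comp_elim]
  | @rel n l R ts =>
    rcases R with R | R
    · cases R
      convert (IsCell.pos ((affine Λ M _).sub_mem (realize_mem_affine (ts 1))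
        (realize_mem_affine (ts 0)))).isCellUnion using 1
      ext x
      simp only [mem_ofPred_eq, Pi.sub_apply, sub_pos, BoundedFormula.Realize, Sum.elim_comp_inl_inr]
      rfl
    · exact isEmptyElim R
  | imp φ ψ hφ hψ =>
    convert hφ.compl.union hψ using 1
    ext x
    simp [BoundedFormula.Realize, imp_iff_not_or]
  | @all n φ ih =>
    convert (ih.comap comp_snoc_mem).compl.image_fst.compl using 1
    ext x
    simp [BoundedFormula.Realize, Sum.elim_comp_inl, Sum.elim_comp_inr]

theorem isCellUnion_of_definable {s : Set (ι → M)}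
    (hs : (Set.univ : Set M).Definable (ovsLanguage Λ) s) : IsCellUnion (affine Λ M ι) s := by
  obtain ⟨φ, rfl⟩ := hs
  have hmem : ∀ f ∈ affine Λ M (ι ⊕ Fin 0),
      (f ∘ fun x : ι → M => Sum.elim x default) ∈ affine Λ M ι := by
    rintro _ ⟨c, a, rfl⟩
    exact ⟨c, a ∘ Sum.inl, by ext x; simp⟩
  convert (isCellUnion_realize φ).comap hmem using 1
  ext x
  simp only [mem_ofPred_eq, mem_preimage, Sum.elim_comp_inl, Sum.elim_comp_inr]
  rfl

end Definable

/-! ### Counting points of grids -/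

section Grid

variable {M : Type v} {r : ℕ} {d : Fin r → ℕ} {E E' : Set ((i : Fin r) → (Fin (d i) → M))}

theorem InftyFree.mono (h : InftyFree E) (hE : E' ⊆ E) : InftyFree E' :=
  fun ⟨B, hB, hBE⟩ => h ⟨B, hB, hBE.trans hE⟩

theorem HasLinearZBounds.empty :
    HasLinearZBounds (∅ : Set ((i : Fin r) → (Fin (d i) → M))) :=
  ⟨1, one_pos, fun B => by simp⟩

theorem HasLinearZBounds.union (h : HasLinearZBounds E) (h' : HasLinearZBounds E') :
    HasLinearZBounds (E ∪ E') := by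
  obtain ⟨α, hα, h⟩ := h
  obtain ⟨β, hβ, h'⟩ := h'
  refine ⟨α + β, add_pos hα hβ, fun B => ?_⟩
  rw [union_inter_distrib_right, add_mul]
  exact (Nat.cast_le.2 (ncard_union_le _ _)).trans (by push_cast; exact add_le_add (h B) (h' B))

/-- If the points of `E` are determined by their blocks other than `i`, then `E` meets a grid `B`
in at most `∏ j ≠ i, |B j|` points. -/
theorem hasLinearZBounds_of_injOn (i : Fin r)
    (h : ∀ x ∈ E, ∀ y ∈ E, (∀ j ≠ i, x j = y j) → x = y) : HasLinearZBounds E := by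
  classical
  refine ⟨1, one_pos, fun B => ?_⟩
  rw [one_mul, Nat.cast_le]
  calc (E ∩ grid fun i => (B i : Set (Fin (d i) → M))).ncard
      ≤ (Fintype.piFinset (fun j : {j // j ≠ i} => B j.1) :
          Set ((j : {j // j ≠ i}) → (Fin (d j.1) → M))).ncard := by
        refine ncard_le_ncard_of_injOn (fun x (j : {j // j ≠ i}) => x j.1) ?_ ?_ (Finset.finite_toSet _)
        · intro x hx
          rw [Finset.mem_coe, Fintype.mem_piFinset]
          exact fun j => hx.2 j
        · intro x hx y hy hxy
          exact h x hx.1 y hy.1 fun j hj => congrFun hxy ⟨j, hj⟩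
    _ = ∏ j ∈ Finset.univ.erase i, (B j).card := by
        rw [ncard_coe_finset, Fintype.card_piFinset]
        exact (Finset.prod_subtype _ (by simp) fun j => (B j).card).symm
    _ ≤ delta B := by
        refine Finset.single_le_sum (f := fun s => ∏ j ∈ s, (B j).card)
          (fun _ _ => Nat.zero_le _) ?_
        rw [Finset.mem_powersetCard]
        exact ⟨Finset.subset_univ _, by simp [Finset.card_erase_of_mem]⟩

end Grid

/-! ### The dichotomy for cells -/

section Dichotomy

variable {Λ : Type u} {M : Type v} {κ : Type*} [Fintype κ]
  [DivisionRing Λ] [AddCommGroup M] [Module Λ M]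

/-- If the rows `R` span `Λ ^ κ` on the left, then a common zero `x` in `M ^ κ` is killed by all of
`Λ ^ κ`, hence is `0`; otherwise some nonzero linear functional vanishes on the span. -/
theorem exists_ne_zero_or_eq_zero (R : Set (κ → Λ)) :
    (∃ b : κ → Λ, b ≠ 0 ∧ ∀ a ∈ R, ∑ j, a j * b j = 0) ∨
      ∀ x : κ → M, (∀ a ∈ R, ∑ j, a j • x j = 0) → x = 0 := by
  classical
  by_cases hR : Submodule.span Λ R = ⊤
  · right
    intro x hx
    have hker : Submodule.span Λ R ≤ LinearMap.ker (Fintype.linearCombination Λ x) :=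
      Submodule.span_le.2 fun a ha => hx a ha
    ext k
    have : Fintype.linearCombination Λ x (Pi.single k 1) = 0 := hker (hR ▸ Submodule.mem_top)
    simpa using this
  · left
    obtain ⟨φ, hφ, hle⟩ := Submodule.exists_le_ker_of_lt_top _ (lt_top_iff_ne_top.2 hR)
    have hsum : ∀ a : κ → Λ, φ a = ∑ j, a j * φ (Pi.single j 1) := by
      intro a
      conv_lhs => rw [pi_eq_sum_univ' a]
      simp [map_sum]
    refine ⟨fun j => φ (Pi.single j 1), fun h0 => hφ ?_, fun a ha => ?_⟩
    · ext j
      simpa using congrFun h0 j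
    · rw [← hsum]
      exact hle (Submodule.subset_span ha)

variable [LinearOrder Λ] [IsStrictOrderedRing Λ] [LinearOrder M] [IsOrderedAddMonoid M]
  [IsStrictOrderedModule Λ M]

/-- A strict affine inequality is preserved by small positive perturbations. No archimedean
property is available, so the bound is obtained by scaling the value `y` by elements of `Λ`. -/
theorem exists_pos_forall_pos_add_sum {y : M} (hy : 0 < y) (c : κ → Λ) :
    ∃ δ : M, 0 < δ ∧ ∀ m : κ → M, (∀ i, 0 < m i ∧ m i < δ) → 0 < y + ∑ i, c i • m i := by
  -- `δ = C⁻¹ • y` works as soon as `C > ∑ i, |c i|`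
  set C : Λ := ∑ i, |c i| + 1 with hC
  have hC0 : 0 < C := by positivity
  refine ⟨C⁻¹ • y, smul_pos (inv_pos.2 hC0) hy, fun m hm => ?_⟩
  have h1 : ∑ i, -(|c i| • C⁻¹ • y) ≤ ∑ i, c i • m i := by
    refine Finset.sum_le_sum fun i _ => ?_
    calc -(|c i| • C⁻¹ • y) ≤ -(|c i| • m i) :=
          neg_le_neg (smul_le_smul_of_nonneg_left (hm i).2.le (abs_nonneg _))
      _ = (-|c i|) • m i := (neg_smul _ _).symm
      _ ≤ c i • m i := smul_le_smul_of_nonneg_right (neg_abs_le _) (hm i).1.le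
  have h2 : y + ∑ i, -(|c i| • C⁻¹ • y) = C⁻¹ • y := by
    rw [Finset.sum_neg_distrib, ← Finset.sum_smul]
    have : y = C • C⁻¹ • y := (smul_inv_smul₀ hC0.ne' y).symm
    conv_lhs => rw [this]
    rw [inv_smul_smul₀ hC0.ne', ← sub_eq_add_neg, ← sub_smul, hC, add_sub_cancel_left, one_smul]
  calc (0 : M) < C⁻¹ • y := smul_pos (inv_pos.2 hC0) hy
    _ = y + ∑ i, -(|c i| • C⁻¹ • y) := h2.symm
    _ ≤ y + ∑ i, c i • m i := by gcongr

end Dichotomy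

section Zar

variable {Λ : Type u} {M : Type v} {r : ℕ} {d : Fin r → ℕ}
  [DivisionRing Λ] [LinearOrder Λ] [IsStrictOrderedRing Λ]
  [AddCommGroup M] [LinearOrder M] [IsOrderedAddMonoid M]
  [Module Λ M] [IsStrictOrderedModule Λ M] [Nontrivial M]

/-- Either the equations of the cell determine some block of coordinates from the remaining ones,
or each block can be moved along a line without affecting the equations, and then the cell contains
an infinite grid around each of its points. -/
theorem IsCell.zarInfty {s : Set ((Σ i : Fin r, Fin (d i)) → M)}
    (hs : IsCell (affine Λ M (Σ i : Fin r, Fin (d i))) s) :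
    ZarInfty {x : (i : Fin r) → (Fin (d i) → M) | (fun q : Σ i : Fin r, Fin (d i) => x q.1 q.2) ∈ s}
    := by
  intro hfree
  obtain ⟨F, G, -, hG, hFL, hGL, rfl⟩ := hs
  have hFL' : ∀ f ∈ F, ∃ (c : M) (a : (Σ i : Fin r, Fin (d i)) → Λ),
    f = fun x => c + ∑ q, a q • x q := fun f hf => hFL hf
  have hGL' : ∀ f ∈ G, ∃ (c : M) (a : (Σ i : Fin r, Fin (d i)) → Λ),
    f = fun x => c + ∑ q, a q • x q := fun f hf => hGL hf
  choose! cF aF hF using hFL'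
  choose! cG aG hGa using hGL'
  by_cases hdet : ∃ i, ∀ x : Fin (d i) → M,
      (∀ a ∈ (fun f j => aF f ⟨i, j⟩) '' F, ∑ j, a j • x j = 0) → x = 0
  · obtain ⟨i, hi⟩ := hdet
    refine hasLinearZBounds_of_injOn i fun x hx y hy hxy => ?_
    have hz : x i - y i = 0 := by
      refine hi _ ?_
      rintro _ ⟨f, hf, rfl⟩
      have hx0 := hx.1 f hf
      have hy0 := hy.1 f hf
      rw [hF f hf] at hx0 hy0
      have h := hx0.trans hy0.symm
      simp only [add_right_inj, Fintype.sum_sigma] at h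
      rw [← sub_eq_zero, ← Finset.sum_sub_distrib, Finset.sum_eq_single i] at h
      · simpa [smul_sub] using h
      · intro j _ hj
        rw [hxy j hj, sub_self]
      · simp
    funext j
    by_cases hj : j = i
    · subst hj
      exact sub_eq_zero.1 hz
    · exact hxy j hj
  · push Not at hdet
    rcases eq_empty_or_nonempty {x : (i : Fin r) → (Fin (d i) → M) |
        (fun q : Σ i : Fin r, Fin (d i) => x q.1 q.2) ∈
          {x | (∀ f ∈ F, f x = 0) ∧ ∀ g ∈ G, 0 < g x}} with hE | ⟨p, hp⟩
    · rw [hE]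
      exact .empty
    refine absurd ?_ hfree
    have hb : ∀ i, ∃ b : Fin (d i) → Λ, b ≠ 0 ∧
        ∀ a ∈ (fun f j => aF f ⟨i, j⟩) '' F, ∑ j, a j * b j = 0 := by
      intro i
      obtain ⟨x, hx, hx0⟩ := hdet i
      rcases exists_ne_zero_or_eq_zero (M := M) ((fun f j => aF f ⟨i, j⟩) '' F) with h | h
      · exact h
      · exact absurd (h x hx) hx0
    choose b hb0 hb using hb
    -- the effect on an affine function of moving block `i` by `b i • m i`
    have hmove : ∀ (a : (Σ i : Fin r, Fin (d i)) → Λ) (m : Fin r → M),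
        ∑ q, a q • (p q.1 q.2 + b q.1 q.2 • m q.1) =
          ∑ q, a q • p q.1 q.2 + ∑ i, (∑ j, a ⟨i, j⟩ * b i j) • m i := by
      intro a m
      simp only [smul_add, Finset.sum_add_distrib, Fintype.sum_sigma, Finset.sum_smul, mul_smul]
    have hδ : ∀ g ∈ G, ∃ δ : M, 0 < δ ∧ ∀ m : Fin r → M, (∀ i, 0 < m i ∧ m i < δ) →
        0 < g fun q => p q.1 q.2 + b q.1 q.2 • m q.1 := by
      intro g hg
      have hpg := hp.2 g hg
      rw [hGa g hg] at hpg
      obtain ⟨δ, hδ0, hδ⟩ := exists_pos_forall_pos_add_sum hpg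
        (fun i => ∑ j, aG g ⟨i, j⟩ * b i j)
      refine ⟨δ, hδ0, fun m hm => ?_⟩
      rw [hGa g hg]
      simp only [hmove, ← add_assoc]
      exact hδ m hm
    choose! δ hδ0 hδ using hδ
    have : DenselyOrdered M := denselyOrdered_of_module Λ M
    obtain ⟨ε, hε0, hε⟩ := Order.exists_between_finsets {0} (hG.toFinset.image δ) (by
      intro x hx y hy
      simp only [Finset.mem_singleton, Finset.mem_image, Finite.mem_toFinset] at hx hy
      obtain ⟨g, hg, rfl⟩ := hy
      exact hx ▸ hδ0 g hg)
    have hε0 : 0 < ε := hε0 0 (Finset.mem_singleton_self 0)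
    refine ⟨fun i => (fun m : M => fun j => p i j + b i j • m) '' Ioo 0 ε, fun i => ?_, ?_⟩
    · refine (Ioo_infinite hε0).image fun m _ m' _ hmm => ?_
      obtain ⟨j, hj⟩ := Function.ne_iff.1 (hb0 i)
      exact smul_right_injective M hj (add_left_cancel (congrFun hmm j))
    · intro x hx
      choose m hm hmx using hx
      obtain rfl : (fun i j => p i j + b i j • m i) = x := funext hmx
      refine ⟨fun f hf => ?_, fun g hg => ?_⟩
      · have hpf := hp.1 f hf
        rw [hF f hf] at hpf ⊢
        simp only [hmove, ← add_assoc]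
        refine (congrArg (· + _) hpf).trans ((zero_add _).trans ?_)
        refine Finset.sum_eq_zero fun i _ => ?_
        rw [hb i _ (mem_image_of_mem _ hf), zero_smul]
      · exact hδ g hg m fun i => ⟨(hm i).1, (hm i).2.trans
          (hε _ (Finset.mem_image_of_mem _ (hG.mem_toFinset.2 hg)))⟩

theorem IsCellUnion.zarInfty {s : Set ((Σ i : Fin r, Fin (d i)) → M)}
    (hs : IsCellUnion (affine Λ M (Σ i : Fin r, Fin (d i))) s) :
    ZarInfty {x : (i : Fin r) → (Fin (d i) → M) | (fun q : Σ i : Fin r, Fin (d i) => x q.1 q.2) ∈ s}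
    := by
  induction hs with
  | empty => exact fun _ => HasLinearZBounds.empty
  | cell_union h _ ih =>
    intro hfree
    exact (h.zarInfty (hfree.mono fun _ hx => Or.inl hx)).union
      (ih (hfree.mono fun _ hx => Or.inr hx))

end Zar

end Zarankiewicz

theorem corollary2p23 {Λ : Type*} {M : Type*}
    [DivisionRing Λ] [LinearOrder Λ] [IsStrictOrderedRing Λ]
    [AddCommGroup M] [LinearOrder M] [IsOrderedAddMonoid M]
    [Module Λ M] [IsStrictOrderedModule Λ M]
    (r : ℕ) (hr : 0 < r) (d : Fin r → ℕ) (hd : ∀ i, 0 < d i)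
    (E : Set ((i : Fin r) → (Fin (d i) → M)))
    (hE : Zarankiewicz.IsSemilinear Λ E) :
    Zarankiewicz.ZarInfty E := by
  rcases subsingleton_or_nontrivial M with hM | hM
  · -- `E` has at most one point
    intro _
    exact Zarankiewicz.hasLinearZBounds_of_injOn ⟨0, hr⟩ fun x _ y _ _ => Subsingleton.elim x y
  · exact (Zarankiewicz.isCellUnion_of_definable hE).zarInfty
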